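/- Let $M$ be a connected orientable 3-manifold that is the interior of a compact 3-manifold whose boundary consists of $r\ge 1$ tori, and let $\mathcal T$ be an (oriented) ideal triangulation of $M$ with $N$ tetrahedra $\Delta_1,\dots,\Delta_N$ and hence $N$ edges $e_1,\dots,e_N$. In each $\Delta_j$ let $q_j\to q_j'\to q_j''\to q_j$ be the three quad types (equivalently, the three pairs of opposite edges of $\Delta_j$) in the cyclic order given by the orientation, and let $\bar a_{ij},\bar b_{ij},\bar c_{ij}\in\{0,1,2\}$ be the number of edges of $\Delta_j$ facing $q_j,q_j',q_j''$ respectively that are identified to $e_i$, i.e. the coefficients of the angle variables $Z_j,Z_j',Z_j''$ in the $i$th edge equation $\sum_j(\bar a_{ij}Z_j+\bar b_{ij}Z_j'+\bar c_{ij}Z_j'')=2\pi$. Choose one quad type in each tetrahedron and eliminate its variable by means of $Z_j+Z_j'+Z_j''=\pi$; let $E_i\in\mathbb Z^{2N}$ be the resulting vector of coefficients of the $i$th edge equation (if the $Z_j'$ are eliminated, $E_i=(\bar a_{ij}-\bar b_{ij}\mid \bar c_{ij}-\bar b_{ij})_{j=1,\dots,N}$), and let $\Lambda=\{\sum_i k_iE_i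 : k\in\mathbb Z^N\}\subset\mathbb Z^{2N}$. Let $G$ be the multigraph whose vertices are the $r$ cusps of $M$ and whose edges are $e_1,\dots,e_N$, each joining the cusps at its two ends (loops and multiple edges are allowed). A set of edges of $G$ is a \emph{maximal tree with 1- or 3-cycle} if it consists of the edges of some maximal (spanning) tree $T$ of $G$ together with one additional edge that either is a loop or forms a 3-cycle together with two edges of $T$. Then, for every choice of quad types, there is an integer basis of $\Lambda$ consisting of $N-r$ of the vectors $E_1,\dots,E_N$. In fact, $G$ contains a maximal tree with 1- or 3-cycle, and for every maximal tree with 1- or 3-cycle $S$ in $G$, the set $S$ has exactly $r$ edges and the $N-r$ vectors $E_i$ with $e_i\notin S$ form an integer basis of $\Lambda$. -/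

import Mathlib

/-- The edges of the standard 3-simplex with vertices `0, 1, 2, 3`: unordered pairs of distinct
vertices. -/
abbrev TetEdge : Type := {p : Sym2 (Fin 4) // ¬ p.IsDiag}

/-- `N` oriented tetrahedra, each a copy of the standard simplex with vertices `0, 1, 2, 3`, whose
faces are identified in pairs by orientation-reversing simplicial maps. Face `f` of a tetrahedron is
the face opposite to vertex `f`. Face `f` of `t` is identified with face `perm t f f` of `adj t f`,
each vertex `v ≠ f` going to the vertex `perm t f v`. -/
structure OrientedFacePairing (N : ℕ) where
  adj : Fin N → Fin 4 → Fin N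
  perm : Fin N → Fin 4 → Equiv.Perm (Fin 4)
  adj_adj : ∀ t f, adj (adj t f) (perm t f f) = t
  perm_adj : ∀ t f, perm (adj t f) (perm t f f) = (perm t f)⁻¹
  /-- No face is paired with itself. -/
  face_ne : ∀ t f, (adj t f, perm t f f) ≠ (t, f)
  /-- All face identifications respect the orientations of the tetrahedra. -/
  sign_perm : ∀ t f, Equiv.Perm.sign (perm t f) = -1

namespace OrientedFacePairing

variable {N : ℕ} (T : OrientedFacePairing N)

/-- The elementary identifications between the vertices `(t, v)` of the tetrahedra. -/
def VertexGlued (x y : Fin N × Fin 4) : Prop :=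
  ∃ f : Fin 4, f ≠ x.2 ∧ y = (T.adj x.1 f, T.perm x.1 f x.2)

/-- The ideal vertices (cusps) of the quotient space. -/
def Cusp : Type := Quot T.VertexGlued

/-- The cusp at vertex `v` of tetrahedron `t`. -/
def cusp (t : Fin N) (v : Fin 4) : T.Cusp := Quot.mk _ (t, v)

/-- The elementary identifications between the edges `(t, p)` of the tetrahedra. -/
def EdgeGlued (x y : Fin N × TetEdge) : Prop :=
  ∃ f : Fin 4, f ∉ x.2.1 ∧ y.1 = T.adj x.1 f ∧ y.2.1 = x.2.1.map (T.perm x.1 f)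

/-- The edges of the quotient space. -/
def Edge : Type := Quot T.EdgeGlued

/-- The edge of the quotient space that is the image of edge `p` of tetrahedron `t`. -/
def edge (t : Fin N) (p : TetEdge) : T.Edge := Quot.mk _ (t, p)

theorem cusp_perm (t : Fin N) {f v : Fin 4} (h : f ≠ v) :
    T.cusp (T.adj t f) (T.perm t f v) = T.cusp t v :=
  (Quot.sound ⟨f, h, rfl⟩).symm

/-- The two (possibly equal) cusps at the ends of an edge. -/
def ends : T.Edge → Sym2 T.Cusp :=
  Quot.lift (fun x => x.2.1.map (T.cusp x.1)) (by
    rintro ⟨t, p, hp⟩ ⟨t', p', hp'⟩ ⟨f, hf, h1, h2⟩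
    simp only at hf h1 h2
    subst h1 h2
    rw [Sym2.map_map]
    refine Sym2.map_congr fun v hv => ?_
    exact (T.cusp_perm t (by rintro rfl; exact hf hv)).symm)

/-! The link of a cusp `h` is the closed surface triangulated by one triangle for each vertex
`(t, v)` of a tetrahedron that lies at `h`. The triangle at `(t, v)` has a corner on each edge
`{v, w}` of `t` and a side in each face `f` of `t`, where `w, f ≠ v`; the corners as well as the
sides are indexed by ordered pairs of distinct vertices of `t`. -/

/-- Corners or sides of the link triangles: `(t, v, w)` with `v ≠ w`. -/
abbrev LinkFlag (N : ℕ) : Type := {x : Fin N × Fin 4 × Fin 4 // x.2.1 ≠ x.2.2}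

/-- Identification of the corners of the link triangles: the corner of the triangle at `(t, v)` on
the edge `{v, w}` is carried along by the pairing of each face that contains this edge. -/
def CornerGlued (x y : LinkFlag N) : Prop :=
  ∃ f : Fin 4, f ≠ x.1.2.1 ∧ f ≠ x.1.2.2 ∧
    y.1 = (T.adj x.1.1 f, T.perm x.1.1 f x.1.2.1, T.perm x.1.1 f x.1.2.2)

/-- Identification of the sides of the link triangles: the side of the triangle at `(t, v)` in the
face `f` is carried along by the pairing of `f`. -/
def SideGlued (x y : LinkFlag N) : Prop :=
  y.1 = (T.adj x.1.1 x.1.2.2, T.perm x.1.1 x.1.2.2 x.1.2.1, T.perm x.1.1 x.1.2.2 x.1.2.2)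

/-- The vertices of the cusp links. -/
def LinkVertex : Type := Quot T.CornerGlued

/-- The edges of the cusp links. -/
def LinkEdge : Type := Quot T.SideGlued

/-- The cusp whose link contains a given link vertex. -/
def LinkVertex.cusp : T.LinkVertex → T.Cusp :=
  Quot.lift (fun x => T.cusp x.1.1 x.1.2.1) (by
    rintro ⟨⟨t, v, w⟩, h⟩ ⟨⟨t', v', w'⟩, h'⟩ ⟨f, hv, hw, e⟩
    simp only [Prod.mk.injEq] at hv hw e
    obtain ⟨rfl, rfl, rfl⟩ := e
    exact (T.cusp_perm t hv).symm)

/-- The cusp whose link contains a given link edge. -/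
def LinkEdge.cusp : T.LinkEdge → T.Cusp :=
  Quot.lift (fun x => T.cusp x.1.1 x.1.2.1) (by
    rintro ⟨⟨t, v, f⟩, h⟩ ⟨⟨t', v', f'⟩, h'⟩ e
    simp only [SideGlued, Prod.mk.injEq] at h e
    obtain ⟨rfl, rfl, rfl⟩ := e
    exact (T.cusp_perm t h.symm).symm)

/-- The Euler characteristic of the link of a cusp. -/
noncomputable def linkEulerChar (h : T.Cusp) : ℤ :=
  (Nat.card {x : T.LinkVertex // LinkVertex.cusp T x = h} : ℤ)
    - Nat.card {x : T.LinkEdge // LinkEdge.cusp T x = h}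
    + Nat.card {x : Fin N × Fin 4 // T.cusp x.1 x.2 = h}

/-- The quotient space is connected. -/
def IsConnected : Prop :=
  0 < N ∧ ∀ t t' : Fin N, Relation.ReflTransGen (fun a b => ∃ f, T.adj a f = b) t t'

/-- The number `r` of cusps. -/
noncomputable def numCusps : ℕ := Nat.card T.Cusp

end OrientedFacePairing

/-- An oriented ideal triangulation, with `N` tetrahedra, of a connected 3-manifold all of whose
cusps are tori. The cusp links are closed connected oriented surfaces, so they are tori exactly
when their Euler characteristics vanish. -/
structure IdealTriangulation (N : ℕ) extends OrientedFacePairing N where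
  connected : toOrientedFacePairing.IsConnected
  torus_cusps : ∀ h, toOrientedFacePairing.linkEulerChar h = 0

/-- The three quad types `q, q', q''` of a tetrahedron are numbered `0, 1, 2`, in their cyclic
order. This is the pair of opposite edges of the tetrahedron faced by each of them. -/
def facingEdges : Fin 3 → Finset TetEdge :=
  ![{⟨s(0, 1), by decide⟩, ⟨s(2, 3), by decide⟩},
    {⟨s(0, 2), by decide⟩, ⟨s(1, 3), by decide⟩},
    {⟨s(0, 3), by decide⟩, ⟨s(1, 2), by decide⟩}]

namespace IdealTriangulation

variable {N : ℕ} (T : IdealTriangulation N)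

open Classical in
/-- The coefficient in the equation of the edge `e` of the angle variable of quad type `k` in the
tetrahedron `j` (for `k = 0, 1, 2`, the entries of the three Neumann-Zagier matrices): the number of
edges of tetrahedron `j` that face this quad type and are identified to `e`. -/
noncomputable def angleCoeff (e : T.Edge) (j : Fin N) (k : Fin 3) : ℤ :=
  ((facingEdges k).filter fun p => T.edge j p = e).card

/-- The row of the Neumann-Zagier matrix `(A | B)` for the edge `e`, where in each tetrahedron `j`
the angle variable of the quad type `Q j` has been eliminated by means of `Z + Z' + Z'' = π`. The
columns of `A` belong to the quad types that precede `Q j` in the cyclic order, those of `B` to the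
ones that follow it: if `Z'` is eliminated, then `A` belongs to `Z` and `B` to `Z''`. -/
noncomputable def edgeEquation (Q : Fin N → Fin 3) (e : T.Edge) : Fin N ⊕ Fin N → ℤ :=
  Sum.elim (fun j => T.angleCoeff e j (Q j - 1) - T.angleCoeff e j (Q j))
    (fun j => T.angleCoeff e j (Q j + 1) - T.angleCoeff e j (Q j))

/-- The lattice spanned by the edge equations. -/
noncomputable def edgeLattice (Q : Fin N → Fin 3) : Submodule ℤ (Fin N ⊕ Fin N → ℤ) :=
  Submodule.span ℤ (Set.range (T.edgeEquation Q))

/-- The edge equations of the edges in `B` form an integer basis of the lattice spanned by all edge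
equations. -/
def IsIntegerBasis (Q : Fin N → Fin 3) (B : Set T.Edge) : Prop :=
  LinearIndependent ℤ (fun e : B => T.edgeEquation Q e) ∧
    Submodule.span ℤ (T.edgeEquation Q '' B) = T.edgeLattice Q

end IdealTriangulation

/-! A multigraph with vertex set `V` and edge set `E` is given by the map `ends : E → Sym2 V` that
sends each edge to its two (possibly equal) ends. -/

/-- The edges in `T` form, together with all vertices, a maximal (spanning) tree of the multigraph:
there are no loops and no multiple edges in `T`, and the resulting simple graph on the vertices is a
tree. -/
def IsMaximalTree {V E : Type*} (ends : E → Sym2 V) (T : Set E) : Prop :=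
  (∀ e ∈ T, ¬ (ends e).IsDiag) ∧ Set.InjOn ends T ∧ (SimpleGraph.fromEdgeSet (ends '' T)).IsTree

/-- `S` consists of a maximal tree `T` together with one additional edge that either is a loop or
forms a 3-cycle together with two edges in `T`. -/
def IsMaximalTreeWithCycle {V E : Type*} (ends : E → Sym2 V) (S : Set E) : Prop :=
  ∃ (T : Set E) (e : E), IsMaximalTree ends T ∧ e ∉ T ∧ S = insert e T ∧
    ((ends e).IsDiag ∨
      ∃ x y z : V, x ≠ y ∧ y ≠ z ∧ z ≠ x ∧ ends e = s(x, y) ∧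
        ∃ f ∈ T, ∃ g ∈ T, ends f = s(y, z) ∧ ends g = s(z, x))

/-!
A vector of coefficients `k` gives a relation between the edge equations exactly if, in each
tetrahedron, the sums of `k` over the three pairs of opposite edges agree: the choice of quad types
plays no role. In a single tetrahedron this means that `2 k` is the sum of weights of the two ends,
where the weight of a vertex `v` is `k(vu) + k(vw) - k(uw)` for any face `vuw` that contains `v`.
Since the weight can be computed in any such face, it is respected by the face pairings and defines
an integer function `b` on the cusps. So the relations are the integral functions
`e ↦ (b(v) + b(w)) / 2`, with `v` and `w` the ends of `e`
(`IdealTriangulation.sum_smul_edgeEquation_eq_zero_iff_exists`).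

Let `S` be a maximal tree with 1- or 3-cycle. The values of a relation at the edges of the cycle
determine `b` at one cusp, and the values along the tree then determine it everywhere. Conversely,
arbitrary integers on `S` arise in this way, and all values of the resulting `b` have the same
parity, so that `b` gives an integral relation (`IsMaximalTreeWithCycle.eq_zero_of_endSum`,
`IsMaximalTreeWithCycle.exists_endSum`). Hence the relations form a complement of `ℤ^(E \ S)` in
`ℤ^E`, which says that the equations of the edges outside `S` form an integer basis
(`IdealTriangulation.isIntegerBasis_compl`).

There are as many edges as tetrahedra because the Euler characteristics of the cusp links add up to
`2E - 6N + 4N = 0` (`OrientedFacePairing.card_edge`). Here each edge contributes two link vertices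
because the orientation prevents an edge from being identified with its own reverse
(`OrientedFacePairing.not_sameCycle_reverse`). Finally, a face of a tetrahedron yields a loop or a
3-cycle, and a spanning tree can be chosen to contain two edges of the latter
(`exists_isMaximalTreeWithCycle`).
-/

/-! ### Counting the edges -/

/-- If `π : X → Y` is surjective and each of its fibres is `{x, ι x}` for a map `ι` without fixed
points, then `X` has twice as many elements as `Y`. -/
theorem Nat.card_eq_two_mul_of_fixedPointFree {X Y : Type*} [Finite X] (π : X → Y)
    (hπ : Function.Surjective π) (ι : X → X) (hι : ∀ x, ι x ≠ x)
    (h : ∀ x y, π y = π x ↔ y = x ∨ y = ι x) : Nat.card X = 2 * Nat.card Y := by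
  have : Finite Y := Finite.of_surjective π hπ
  have := Fintype.ofFinite Y
  rw [Nat.card_congr (Equiv.sigmaFiberEquiv π).symm, Nat.card_sigma]
  have hfib : ∀ y, Nat.card {x // π x = y} = 2 := by
    intro y
    obtain ⟨x, rfl⟩ := hπ y
    have : {z | π z = π x} = {x, ι x} := by
      ext z
      simp [h x z]
    rw [← Set.ncard_pair (hι x).symm, ← this]
    rfl
  simp [hfib, mul_comm]

/-- A finite type is the disjoint union of the fibres of a map to another finite type. -/
theorem Nat.card_eq_sum_card_fiber {X Y : Type*} [Finite X] [Fintype Y] (π : X → Y) :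
    Nat.card X = ∑ y, Nat.card {x // π x = y} := by
  rw [Nat.card_congr (Equiv.sigmaFiberEquiv π).symm, Nat.card_sigma]

theorem Equiv.Perm.exists_sign_eq_one_of_ne {v w : Fin 4} (h : v ≠ w) :
    ∃ τ : Equiv.Perm (Fin 4), τ 0 = v ∧ τ 1 = w ∧ sign τ = 1 := by
  revert v w
  decide

theorem Equiv.Perm.eq_of_sign_eq {τ τ' : Equiv.Perm (Fin 4)} (h0 : τ 0 = τ' 0)
    (h1 : τ 1 = τ' 1) (hs : sign τ = sign τ') : τ = τ' := by
  have key : ∀ ρ : Equiv.Perm (Fin 4), ρ 0 = 0 → ρ 1 = 1 → sign ρ = 1 → ρ = 1 := by decide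
  have := key (τ⁻¹ * τ') (by simp [← h0]) (by simp [← h1]) (by simp [hs])
  exact (inv_mul_eq_one.mp this)

namespace OrientedFacePairing

variable {N : ℕ} (T : OrientedFacePairing N)

instance : Finite T.Edge := inferInstanceAs (Finite (Quot _))
instance : Finite T.Cusp := inferInstanceAs (Finite (Quot _))
instance : Finite T.LinkVertex := inferInstanceAs (Finite (Quot _))
instance : Finite T.LinkEdge := inferInstanceAs (Finite (Quot _))

/-- The side of a link triangle that is glued to a given one. -/
def sideFlip (x : LinkFlag N) : LinkFlag N :=
  ⟨(T.adj x.1.1 x.1.2.2, T.perm x.1.1 x.1.2.2 x.1.2.1, T.perm x.1.1 x.1.2.2 x.1.2.2),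
    fun h => x.2 ((T.perm _ _).injective h)⟩

theorem sideFlip_sideFlip (x : LinkFlag N) : T.sideFlip (T.sideFlip x) = x := by
  obtain ⟨⟨t, v, f⟩, h⟩ := x
  simp [sideFlip, T.adj_adj, T.perm_adj]

theorem sideFlip_ne (x : LinkFlag N) : T.sideFlip x ≠ x := by
  obtain ⟨⟨t, v, f⟩, h⟩ := x
  intro e
  simp only [sideFlip, Subtype.mk.injEq, Prod.mk.injEq] at e
  exact T.face_ne t f (Prod.ext e.1 e.2.2)

theorem sideGlued_iff (x y : LinkFlag N) : T.SideGlued x y ↔ y = T.sideFlip x :=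
  (Subtype.ext_iff (a1 := y) (a2 := T.sideFlip x)).symm

theorem linkEdge_mk_eq_iff (x y : LinkFlag N) :
    (Quot.mk T.SideGlued y = Quot.mk T.SideGlued x) ↔ y = x ∨ y = T.sideFlip x := by
  constructor
  · intro h
    have := Quot.eqvGen_exact h
    induction this with
    | rel a b hab => right; rw [(T.sideGlued_iff a b).1 hab, sideFlip_sideFlip]
    | refl a => exact Or.inl rfl
    | symm a b _ ih =>
      rcases ih (Quot.eqvGen_sound ‹_›) with rfl | rfl
      · exact Or.inl rfl
      · right; rw [sideFlip_sideFlip]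
    | trans a b c h1 h2 ih1 ih2 =>
      rcases ih1 (Quot.eqvGen_sound h1) with rfl | rfl
      · exact ih2 (Quot.eqvGen_sound h2)
      · rcases ih2 (Quot.eqvGen_sound h2) with rfl | rfl
        · exact Or.inr rfl
        · left; rw [sideFlip_sideFlip]
  · rintro (rfl | rfl)
    · rfl
    · exact (Quot.sound ((T.sideGlued_iff _ _).2 rfl)).symm

theorem card_linkFlag : Nat.card (LinkFlag N) = 12 * N := by
  have e : LinkFlag N ≃ Fin N × {p : Fin 4 × Fin 4 // p.1 ≠ p.2} :=
    { toFun := fun x => (x.1.1, ⟨x.1.2, x.2⟩)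
      invFun := fun x => ⟨(x.1, x.2.1), x.2.2⟩
      left_inv := fun _ => rfl
      right_inv := fun _ => rfl }
  have h : Fintype.card {p : Fin 4 × Fin 4 // p.1 ≠ p.2} = 12 := by decide
  rw [Nat.card_congr e, Nat.card_prod, Nat.card_fin, Nat.card_eq_fintype_card, h, mul_comm]

theorem card_linkEdge : Nat.card T.LinkEdge = 6 * N := by
  have h := Nat.card_eq_two_mul_of_fixedPointFree (Y := T.LinkEdge) (Quot.mk T.SideGlued)
    Quot.mk_surjective T.sideFlip T.sideFlip_ne T.linkEdge_mk_eq_iff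
  rw [card_linkFlag] at h
  omega

/-! ### No edge is identified with its own reverse -/

/-- Rotation about an edge. The pair `(t, τ)` stands for the tetrahedron `t` with its vertices
ordered as `τ 0, τ 1, τ 2, τ 3`; rotation about the edge from `τ 0` to `τ 1` passes through the face
opposite to `τ 2` and makes this face the one opposite to the last vertex. -/
def rotate : Equiv.Perm (Fin N × Equiv.Perm (Fin 4)) where
  toFun x := (T.adj x.1 (x.2 2), T.perm x.1 (x.2 2) * x.2 * Equiv.swap 2 3)
  invFun x := (T.adj x.1 (x.2 3), T.perm x.1 (x.2 3) * x.2 * Equiv.swap 2 3)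
  left_inv x := by
    obtain ⟨t, τ⟩ := x
    simp [T.adj_adj, T.perm_adj, mul_assoc]
  right_inv x := by
    obtain ⟨t, τ⟩ := x
    simp [T.adj_adj, T.perm_adj, mul_assoc]

/-- Reversal of the edge about which one rotates. The exchange of the last two vertices keeps the
orientation of the ordering. -/
def reverse : Equiv.Perm (Fin N × Equiv.Perm (Fin 4)) :=
  (Equiv.refl _).prodCongr (Equiv.mulRight (Equiv.swap 0 1 * Equiv.swap 2 3))

theorem reverse_apply (t : Fin N) (τ : Equiv.Perm (Fin 4)) :
    reverse (t, τ) = (t, τ * (Equiv.swap 0 1 * Equiv.swap 2 3)) := rfl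

/-- The inverse rotation passes through the other face that contains the edge. -/
theorem reverse_semiconjBy_rotate : SemiconjBy reverse T.rotate T.rotate⁻¹ := by
  ext1 ⟨t, τ⟩
  have h : (Equiv.swap 2 3 * (Equiv.swap 0 1 * Equiv.swap 2 3) : Equiv.Perm (Fin 4)) =
    Equiv.swap 0 1 * Equiv.swap 2 3 * Equiv.swap 2 3 := by decide
  have h3 : (Equiv.swap 0 1 * Equiv.swap 2 3 : Equiv.Perm (Fin 4)) 3 = 2 := by decide
  change (T.adj t (τ 2), T.perm t (τ 2) * τ * Equiv.swap 2 3 *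
      (Equiv.swap 0 1 * Equiv.swap 2 3)) =
    (T.adj t (τ ((Equiv.swap 0 1 * Equiv.swap 2 3 : Equiv.Perm (Fin 4)) 3)),
      T.perm t (τ ((Equiv.swap 0 1 * Equiv.swap 2 3 : Equiv.Perm (Fin 4)) 3)) *
        (τ * (Equiv.swap 0 1 * Equiv.swap 2 3)) * Equiv.swap 2 3)
  rw [h3]
  simp only [mul_assoc, h]

theorem reverse_zpow (n : ℤ) (x : Fin N × Equiv.Perm (Fin 4)) :
    reverse ((T.rotate ^ n) x) = (T.rotate ^ (-n)) (reverse x) := by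
  have h := DFunLike.congr_fun (T.reverse_semiconjBy_rotate.zpow_right n) x
  rwa [inv_zpow'] at h

theorem reverse_ne (x : Fin N × Equiv.Perm (Fin 4)) : reverse x ≠ x := by
  obtain ⟨t, τ⟩ := x
  intro h
  have h' : (Equiv.swap 0 1 * Equiv.swap 2 3 : Equiv.Perm (Fin 4)) ≠ 1 := by decide
  simp only [reverse_apply, Prod.mk.injEq, true_and] at h
  exact h' (mul_eq_left.mp h)

theorem reverse_ne_rotate (x : Fin N × Equiv.Perm (Fin 4)) : reverse x ≠ T.rotate x := by
  obtain ⟨t, τ⟩ := x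
  intro h
  simp only [reverse_apply, rotate, Equiv.coe_fn_mk, Prod.mk.injEq] at h
  -- The face opposite to `τ 2` would be paired with itself.
  have h2 := congrArg (fun σ : Equiv.Perm (Fin 4) => σ 3) h.2
  have e1 : (Equiv.swap 0 1 * Equiv.swap 2 3 : Equiv.Perm (Fin 4)) 3 = 2 := by decide
  rw [Equiv.Perm.mul_apply, e1, Equiv.Perm.mul_apply, Equiv.Perm.mul_apply,
    Equiv.swap_apply_right] at h2
  exact T.face_ne t (τ 2) (Prod.ext h.1.symm h2.symm)

/-- The reversal conjugates the rotation to its inverse. So if the reverse of `x` were `x` rotated by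
`n` steps, then `x` rotated by `⌊n / 2⌋` steps would be an ordering whose reverse is either itself or
the result of one more step. -/
theorem not_sameCycle_reverse (x : Fin N × Equiv.Perm (Fin 4)) :
    ¬ T.rotate.SameCycle x (reverse x) := by
  rintro ⟨n, hn⟩
  rcases Int.even_or_odd' n with ⟨m, rfl | rfl⟩
  · apply reverse_ne ((T.rotate ^ m) x)
    rw [reverse_zpow, ← hn, ← Equiv.Perm.mul_apply, ← zpow_add]
    congr 2
    ring
  · apply T.reverse_ne_rotate ((T.rotate ^ m) x)
    rw [reverse_zpow, ← hn, ← Equiv.Perm.mul_apply, ← zpow_add, ← Equiv.Perm.mul_apply,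
      ← zpow_one_add]
    congr 2
    ring

/-- Corners of link triangles that are glued come from rotations of one tetrahedron about an edge.
Here the orientation is used: of the two orderings that begin with `v, w`, the even one is carried
along. -/
theorem sameCycle_rotate_of_eqvGen {x y : LinkFlag N} (h : Relation.EqvGen T.CornerGlued x y)
    {τ τ' : Equiv.Perm (Fin 4)} (hv : τ 0 = x.1.2.1) (hw : τ 1 = x.1.2.2)
    (hs : Equiv.Perm.sign τ = 1) (hv' : τ' 0 = y.1.2.1) (hw' : τ' 1 = y.1.2.2)
    (hs' : Equiv.Perm.sign τ' = 1) : T.rotate.SameCycle (x.1.1, τ) (y.1.1, τ') := by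
  induction h generalizing τ τ' with
  | rel x y h =>
    obtain ⟨f, hfv, hfw, e⟩ := h
    obtain ⟨⟨t, v, w⟩, hx⟩ := x
    obtain ⟨⟨t', v', w'⟩, hy⟩ := y
    simp only [Prod.mk.injEq] at *
    obtain ⟨rfl, rfl, rfl⟩ := e
    subst hv hw
    have hτ' : τ' = T.perm t f * τ * Equiv.swap 2 3 := by
      apply Equiv.Perm.eq_of_sign_eq
      · rw [hv', Equiv.Perm.mul_apply, Equiv.swap_apply_of_ne_of_ne (by decide) (by decide)]
        rfl
      · rw [hw', Equiv.Perm.mul_apply, Equiv.swap_apply_of_ne_of_ne (by decide) (by decide)]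
        rfl
      · rw [hs', map_mul, map_mul, hs, T.sign_perm, Equiv.Perm.sign_swap (by decide)]
        rfl
    obtain ⟨i, rfl⟩ := τ.surjective f
    have hi : i = 2 ∨ i = 3 := by
      fin_cases i <;> simp_all
    subst hτ'
    rcases hi with rfl | rfl
    · exact ⟨1, rfl⟩
    · exact ⟨-1, rfl⟩
  | refl x =>
    rw [Equiv.Perm.eq_of_sign_eq (hv.trans hv'.symm) (hw.trans hw'.symm) (hs.trans hs'.symm)]
  | symm x y _ ih => exact (ih hv' hw' hs' hv hw hs).symm
  | trans x y z _ _ ih1 ih2 =>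
    obtain ⟨ρ, h0, h1, h2⟩ := Equiv.Perm.exists_sign_eq_one_of_ne y.2
    exact (ih1 hv hw hs h0 h1 h2).trans (ih2 h0 h1 h2 hv' hw' hs')

/-- The opposite orientation of the edge on which a corner of a link triangle lies. -/
def LinkFlag.swap (x : LinkFlag N) : LinkFlag N := ⟨(x.1.1, x.1.2.2, x.1.2.1), x.2.symm⟩

theorem linkVertex_mk_swap_ne (x : LinkFlag N) :
    Quot.mk T.CornerGlued (LinkFlag.swap x) ≠ Quot.mk T.CornerGlued x := by
  intro h
  obtain ⟨τ, h0, h1, hs⟩ := Equiv.Perm.exists_sign_eq_one_of_ne x.2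
  have e : Equiv.Perm.sign (Equiv.swap 0 1 * Equiv.swap 2 3 : Equiv.Perm (Fin 4)) = 1 := by decide
  have e0 : (Equiv.swap 0 1 * Equiv.swap 2 3 : Equiv.Perm (Fin 4)) 0 = 1 := by decide
  have e1 : (Equiv.swap 0 1 * Equiv.swap 2 3 : Equiv.Perm (Fin 4)) 1 = 0 := by decide
  apply T.not_sameCycle_reverse (x.1.1, τ)
  rw [reverse_apply]
  refine T.sameCycle_rotate_of_eqvGen (Quot.eqvGen_exact h.symm) h0 h1 hs ?_ ?_ ?_
  · rw [Equiv.Perm.mul_apply, e0, h1]; rfl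
  · rw [Equiv.Perm.mul_apply, e1, h0]; rfl
  · rw [map_mul, hs, e, mul_one]

/-- The other end of the edge on which a link vertex lies. -/
def LinkVertex.opposite : T.LinkVertex → T.LinkVertex :=
  Quot.map LinkFlag.swap fun x y ⟨f, hv, hw, e⟩ =>
    ⟨f, hw, hv, by simp [LinkFlag.swap, e]⟩

/-- The edge of the triangulation on which a link vertex lies. -/
def LinkVertex.edge : T.LinkVertex → T.Edge :=
  Quot.lift (fun x => T.edge x.1.1 ⟨s(x.1.2.1, x.1.2.2), x.2⟩) fun x y ⟨f, hv, hw, e⟩ => by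
    refine Quot.sound ⟨f, ?_, ?_, ?_⟩ <;> simp [e, hv, hw]

/-- Over an edge of the triangulation there are no link vertices other than its two ends. -/
theorem linkVertex_mk_eq_or_of_eqvGen {a b : Fin N × TetEdge}
    (h : Relation.EqvGen T.EdgeGlued a b) {x y : LinkFlag N}
    (hx1 : x.1.1 = a.1) (hx2 : s(x.1.2.1, x.1.2.2) = a.2.1)
    (hy1 : y.1.1 = b.1) (hy2 : s(y.1.2.1, y.1.2.2) = b.2.1) :
    Quot.mk T.CornerGlued y = Quot.mk T.CornerGlued x ∨
      Quot.mk T.CornerGlued y = Quot.mk T.CornerGlued x.swap := by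
  have same : ∀ {x y : LinkFlag N}, x.1.1 = y.1.1 →
      s(x.1.2.1, x.1.2.2) = s(y.1.2.1, y.1.2.2) → y = x ∨ y = x.swap := by
    rintro ⟨⟨t, v, w⟩, hx⟩ ⟨⟨t', v', w'⟩, hy⟩ h1 h2
    simp only [LinkFlag.swap, Subtype.mk.injEq, Prod.mk.injEq, Sym2.eq_iff] at *
    grind
  have swap_congr : ∀ {x y : LinkFlag N}, Quot.mk T.CornerGlued y = Quot.mk T.CornerGlued x →
      Quot.mk T.CornerGlued y.swap = Quot.mk T.CornerGlued x.swap :=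
    fun h => congrArg (LinkVertex.opposite T) h
  have swap_swap : ∀ x : LinkFlag N, x.swap.swap = x := fun _ => rfl
  induction h generalizing x y with
  | rel a b h =>
    obtain ⟨f, hf, e1, e2⟩ := h
    rw [← hx2, Sym2.mem_iff, not_or] at hf
    -- The flag `x` carried along by the pairing of the face `f`.
    let z : LinkFlag N := ⟨(T.adj x.1.1 f, T.perm x.1.1 f x.1.2.1, T.perm x.1.1 f x.1.2.2),
      fun h => x.2 ((T.perm _ _).injective h)⟩
    have hz : Quot.mk T.CornerGlued x = Quot.mk T.CornerGlued z :=
      Quot.sound ⟨f, hf.1, hf.2, rfl⟩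
    have hzy : z.1.1 = y.1.1 := by rw [hy1, e1, ← hx1]
    have hzy2 : s(z.1.2.1, z.1.2.2) = s(y.1.2.1, y.1.2.2) := by
      rw [hy2, e2, ← hx2, ← hx1]; rfl
    rcases same hzy hzy2 with rfl | rfl
    · exact Or.inl hz.symm
    · exact Or.inr (swap_congr hz.symm)
  | refl a =>
    rcases same (hx1.trans hy1.symm) (hx2.trans hy2.symm) with rfl | rfl
    · exact Or.inl rfl
    · exact Or.inr rfl
  | symm a b _ ih =>
    rcases ih hy1 hy2 hx1 hx2 with h | h
    · exact Or.inl h.symm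
    · exact Or.inr (swap_congr h).symm
  | trans a b c _ _ ih1 ih2 =>
    obtain ⟨t, p, hp⟩ := b
    induction p with | h v w => ?_
    let z : LinkFlag N := ⟨(t, v, w), hp⟩
    rcases ih1 (y := z) hx1 hx2 rfl rfl with h | h <;>
    rcases ih2 (x := z) rfl rfl hy1 hy2 with h' | h'
    · exact Or.inl (h'.trans h)
    · exact Or.inr (h'.trans (swap_congr h))
    · exact Or.inr (h'.trans h)
    · exact Or.inl (h'.trans (swap_congr h))

theorem card_linkVertex : Nat.card T.LinkVertex = 2 * Nat.card T.Edge := by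
  refine Nat.card_eq_two_mul_of_fixedPointFree (LinkVertex.edge T) ?_ (LinkVertex.opposite T)
    ?_ ?_
  · rintro ⟨t, p, hp⟩
    induction p with | h v w => exact ⟨Quot.mk _ ⟨(t, v, w), hp⟩, rfl⟩
  · rintro ⟨x⟩
    exact T.linkVertex_mk_swap_ne x
  · rintro ⟨x⟩ ⟨y⟩
    constructor
    · intro h
      exact T.linkVertex_mk_eq_or_of_eqvGen (Quot.eqvGen_exact h.symm) rfl rfl rfl rfl
    · rintro (h | h)
      · rw [h]
      · rw [h]
        exact congrArg (T.edge x.1.1) (Subtype.ext Sym2.eq_swap)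

/-- If all cusp links have Euler characteristic `0`, then there are as many edges as tetrahedra. -/
theorem card_edge (h : ∀ c, T.linkEulerChar c = 0) : Nat.card T.Edge = N := by
  have := Fintype.ofFinite T.Cusp
  have hsum : ∑ c, T.linkEulerChar c = 0 := Finset.sum_eq_zero fun c _ => h c
  simp only [linkEulerChar, Finset.sum_add_distrib, Finset.sum_sub_distrib] at hsum
  simp only [← Nat.cast_sum] at hsum
  have hT := Nat.card_eq_sum_card_fiber (fun x : Fin N × Fin 4 => T.cusp x.1 x.2)
  simp only [Nat.card_prod, Nat.card_fin] at hT
  rw [← Nat.card_eq_sum_card_fiber, ← Nat.card_eq_sum_card_fiber, ← hT, card_linkVertex,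
    card_linkEdge] at hsum
  push_cast at hsum
  omega

end OrientedFacePairing

/-! ### Maximal trees with a cycle -/

/-- The sum of the values of a function at the two ends of an edge. -/
def Sym2.endSum {V : Type*} (b : V → ℤ) : Sym2 V → ℤ :=
  Sym2.lift ⟨fun u v => b u + b v, fun _ _ => add_comm _ _⟩

@[simp]
theorem Sym2.endSum_mk {V : Type*} (b : V → ℤ) (u v : V) :
    Sym2.endSum b s(u, v) = b u + b v := rfl

theorem Sym2.even_endSum {V : Type*} {b : V → ℤ} {m : ℤ} (h : ∀ v, b v ≡ m [ZMOD 2])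
    (s : Sym2 V) : Even (Sym2.endSum b s) := by
  induction s with | h u v =>
  have hu := h u
  have hv := h v
  rw [Sym2.endSum_mk]
  simp only [Int.ModEq] at hu hv
  rw [Int.even_iff]
  omega

namespace SimpleGraph

variable {V : Type*} {G : SimpleGraph V}

/-- The values at the vertices of a walk, starting from `m` and such that the values at the ends of
each edge `s` add up to `x s`. -/
def Walk.alternate (x : Sym2 V → ℤ) (m : ℤ) : ∀ {u v : V}, G.Walk u v → ℤ
  | _, _, .nil => m
  | u, _, .cons (v := v) _ p => x s(u, v) - p.alternate x m

/-- On a tree, the sums at the edges and the value at one vertex can be prescribed. -/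
theorem IsTree.exists_endSum_eq (hG : G.IsTree) (x : Sym2 V → ℤ) (r : V) (m : ℤ) :
    ∃ b : V → ℤ, b r = m ∧ ∀ u v, G.Adj u v → b u + b v = x s(u, v) := by
  choose P hP hP' using fun v => hG.existsUnique_path v r
  have step : ∀ u v, G.Adj u v → u ∉ (P v).support →
      (P u).alternate x m + (P v).alternate x m = x s(u, v) := by
    intro u v h hu
    have e := hP' u (.cons h (P v)) ((hP v).cons hu)
    rw [← e, Walk.alternate]
    ring
  refine ⟨fun v => (P v).alternate x m, ?_, fun u v h => ?_⟩
  · have e := hP' r .nil Walk.IsPath.nil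
    simp only [← e, Walk.alternate]
  · by_cases hu : u ∈ (P v).support
    · have hv := hG.isAcyclic.ne_mem_support_of_support_of_adj_of_isPath
        (hP v).reverse (hP u).reverse h.symm (by simpa using hu)
      rw [add_comm, Sym2.eq_swap]
      exact step v u h.symm (by simpa using hv)
    · exact step u v h hu

/-- A property that passes along the edges of a connected graph holds everywhere if it holds at one
vertex. -/
theorem Connected.forall_of_adj (hG : G.Connected) {p : V → Prop}
    (h : ∀ u v, G.Adj u v → p u → p v) {r : V} (hr : p r) (v : V) : p v := by
  obtain ⟨w⟩ := hG r v
  induction w with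
  | nil => exact hr
  | cons hadj _ ih => exact ih (h _ _ hadj hr)

theorem IsAcyclic.not_triangle (hG : G.IsAcyclic) {x y z : V} (hxy : G.Adj x y) (hyz : G.Adj y z)
    (hzx : G.Adj z x) : False := by
  classical
  exact (is3Clique_triple_iff.2 ⟨hxy, hzx.symm, hyz⟩).not_cliqueFree (hG.cliqueFree le_rfl)

theorem isAcyclic_two_edges {x y z : V} (hxy : x ≠ y) (hzx : z ≠ x) :
    (edge y z ⊔ edge z x).IsAcyclic := by
  have h1 : (edge y z).IsAcyclic := by
    rw [← bot_sup_eq (edge y z), isAcyclic_sup_fromEdgeSet_iff]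
    exact ⟨isAcyclic_bot, fun h => Or.inl (by simpa using h)⟩
  refine IsAcyclic.sup_edge_of_not_reachable ?_ h1
  rintro ⟨w⟩
  cases w.reverse with
  | nil => exact hzx rfl
  | cons h _ =>
    rw [edge_adj] at h
    grind

end SimpleGraph

section Multigraph

variable {V E : Type*} {ends : E → Sym2 V}

theorem IsMaximalTree.adj {T : Set E} (hT : IsMaximalTree ends T) {e : E} (he : e ∈ T) {u v : V}
    (h : ends e = s(u, v)) : (SimpleGraph.fromEdgeSet (ends '' T)).Adj u v := by
  rw [SimpleGraph.fromEdgeSet_adj]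
  refine ⟨⟨e, he, h⟩, fun huv => hT.1 e he ?_⟩
  rw [h, huv]
  rfl

theorem IsMaximalTree.ncard_add_one [Finite V] {T : Set E} (hT : IsMaximalTree ends T) :
    T.ncard + 1 = Nat.card V := by
  classical
  have := Fintype.ofFinite V
  have h := hT.2.2.card_edgeFinset
  have e : ends '' T \ Sym2.diagSet = ends '' T := by
    rw [sdiff_eq_left, Set.disjoint_left]
    rintro _ ⟨e, he, rfl⟩
    exact hT.1 e he
  rw [← Set.ncard_coe_finset, SimpleGraph.coe_edgeFinset, SimpleGraph.edgeSet_fromEdgeSet,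
    e, hT.2.1.ncard_image] at h
  rw [h, Nat.card_eq_fintype_card]

theorem IsMaximalTreeWithCycle.ncard [Finite V] [Finite E] {S : Set E}
    (hS : IsMaximalTreeWithCycle ends S) : S.ncard = Nat.card V := by
  obtain ⟨T, e, hT, he, rfl, -⟩ := hS
  rw [Set.ncard_insert_of_notMem he, hT.ncard_add_one]

/-- Every integer function on a maximal tree with 1- or 3-cycle is half the function of end sums of
an integer function on the vertices all of whose values have the same parity. -/
theorem IsMaximalTreeWithCycle.exists_endSum {S : Set E} (hS : IsMaximalTreeWithCycle ends S)
    (x : E → ℤ) : ∃ b : V → ℤ, (∃ m, ∀ v, b v ≡ m [ZMOD 2]) ∧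
      ∀ e ∈ S, Sym2.endSum b (ends e) = 2 * x e := by
  obtain ⟨T, e₀, hT, he₀, rfl, hcyc⟩ := hS
  have tree : ∀ r m, ∃ b : V → ℤ, b r = m ∧ (∀ v, b v ≡ m [ZMOD 2]) ∧
      ∀ e ∈ T, Sym2.endSum b (ends e) = 2 * x e := by
    intro r m
    have hx : ∃ x' : Sym2 V → ℤ, ∀ e ∈ T, x' (ends e) = x e := by
      classical
      refine ⟨fun s => if h : ∃ e ∈ T, ends e = s then x h.choose else 0, fun e he => ?_⟩
      have h : ∃ e' ∈ T, ends e' = ends e := ⟨e, he, rfl⟩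
      simp only [dif_pos h]
      rw [hT.2.1 h.choose_spec.1 he h.choose_spec.2]
    obtain ⟨x', hx'⟩ := hx
    obtain ⟨b, hr, hb⟩ := hT.2.2.exists_endSum_eq (fun s => 2 * x' s) r m
    refine ⟨b, hr, fun v => ?_, fun e he => ?_⟩
    · refine hT.2.2.connected.forall_of_adj (p := fun v => b v ≡ m [ZMOD 2]) ?_ (r := r) ?_ v
      · intro u v huv hu
        have := hb u v huv
        simp only [Int.ModEq] at *
        omega
      · rw [hr]
    · obtain ⟨u, v, h⟩ : ∃ u v, ends e = s(u, v) := by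
        induction ends e with | h u v => exact ⟨u, v, rfl⟩
      rw [← hx' e he, h]
      exact hb u v (hT.adj he h)
  rcases hcyc with hloop | ⟨u, v, w, -, -, -, he, f, hf, g, hg, hfe, hge⟩
  · obtain ⟨r, h⟩ : ∃ r, ends e₀ = s(r, r) := by
      induction hs : ends e₀ with | h u v =>
      rw [hs, Sym2.mk_isDiag_iff] at hloop
      exact ⟨u, by rw [hloop]⟩
    obtain ⟨b, hr, hb, hbT⟩ := tree r (x e₀)
    refine ⟨b, ⟨_, hb⟩, ?_⟩
    rintro e (rfl | he)
    · rw [h, Sym2.endSum_mk, hr, two_mul]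
    · exact hbT e he
  · -- The values at the vertices of the triangle are determined by the three edges of the cycle.
    obtain ⟨b, hr, hb, hbT⟩ := tree w (x f + x g - x e₀)
    refine ⟨b, ⟨_, hb⟩, ?_⟩
    rintro e (rfl | he)
    · have h1 := hbT f hf
      have h2 := hbT g hg
      rw [hfe, Sym2.endSum_mk] at h1
      rw [hge, Sym2.endSum_mk] at h2
      rw [he, Sym2.endSum_mk]
      linarith
    · exact hbT e he

/-- A function on the vertices is determined by its end sums on a maximal tree with 1- or
3-cycle. -/
theorem IsMaximalTreeWithCycle.eq_zero_of_endSum {S : Set E} (hS : IsMaximalTreeWithCycle ends S)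
    {b : V → ℤ} (hb : ∀ e ∈ S, Sym2.endSum b (ends e) = 0) : b = 0 := by
  obtain ⟨T, e₀, hT, he₀, rfl, hcyc⟩ := hS
  have hroot : ∃ r, b r = 0 := by
    have h0 := hb e₀ (Set.mem_insert _ _)
    rcases hcyc with hloop | ⟨u, v, w, -, -, -, he, f, hf, g, hg, hfe, hge⟩
    · induction hs : ends e₀ with | h u v =>
      rw [hs, Sym2.mk_isDiag_iff] at hloop
      rw [hs, hloop, Sym2.endSum_mk] at h0
      exact ⟨v, by omega⟩
    · have h1 := hb f (Set.mem_insert_of_mem _ hf)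
      have h2 := hb g (Set.mem_insert_of_mem _ hg)
      rw [hfe, Sym2.endSum_mk] at h1
      rw [hge, Sym2.endSum_mk] at h2
      rw [he, Sym2.endSum_mk] at h0
      exact ⟨w, by omega⟩
  obtain ⟨r, hr⟩ := hroot
  funext v
  refine hT.2.2.connected.forall_of_adj (p := fun v => b v = 0) ?_ hr v
  intro u v huv hu
  rw [SimpleGraph.fromEdgeSet_adj] at huv
  obtain ⟨⟨e, he, h⟩, -⟩ := huv
  have := hb e (Set.mem_insert_of_mem _ he)
  rw [h, Sym2.endSum_mk, hu, zero_add] at this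
  exact this

/-- A spanning tree of the simple graph underlying a multigraph is realized by edges of the
multigraph. -/
theorem exists_isMaximalTree_of_isTree {F : SimpleGraph V} (hF : F.IsTree)
    (hle : F ≤ SimpleGraph.fromEdgeSet (Set.range ends)) :
    ∃ T : Set E, IsMaximalTree ends T ∧ ends '' T = F.edgeSet := by
  have hsub : F.edgeSet ⊆ Set.range ends := by
    intro s hs
    have := SimpleGraph.edgeSet_mono hle hs
    rw [SimpleGraph.edgeSet_fromEdgeSet] at this
    exact this.1
  obtain ⟨T, hT, hinj⟩ := Set.exists_image_eq_injOn_of_subset_range hsub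
  refine ⟨T, ⟨fun e he => ?_, hinj, ?_⟩, hT⟩
  · exact F.not_isDiag_of_mem_edgeSet (hT ▸ Set.mem_image_of_mem _ he)
  · rwa [hT, SimpleGraph.fromEdgeSet_edgeSet]

/-- A connected multigraph with three edges that form a closed path of length three contains a
maximal tree with 1- or 3-cycle. -/
theorem exists_isMaximalTreeWithCycle
    (hconn : (SimpleGraph.fromEdgeSet (Set.range ends)).Connected) {x y z : V} {e f g : E}
    (he : ends e = s(x, y)) (hf : ends f = s(y, z)) (hg : ends g = s(z, x)) :
    ∃ S : Set E, IsMaximalTreeWithCycle ends S := by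
  by_cases hloop : ∃ e, (ends e).IsDiag
  · obtain ⟨e, he⟩ := hloop
    obtain ⟨F, hle, hF⟩ := hconn.exists_isTree_le
    obtain ⟨T, hT, -⟩ := exists_isMaximalTree_of_isTree hF hle
    exact ⟨insert e T, T, e, hT, fun h => hT.1 e h he, rfl, Or.inl he⟩
  · push Not at hloop
    have hxy : x ≠ y := by simpa [he] using hloop e
    have hyz : y ≠ z := by simpa [hf] using hloop f
    have hzx : z ≠ x := by simpa [hg] using hloop g
    obtain ⟨F, hF1, hle, hF⟩ := hconn.exists_isTree_le_of_le_of_isAcyclic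
      (H := SimpleGraph.edge y z ⊔ SimpleGraph.edge z x) (by
        rw [sup_le_iff, SimpleGraph.edge_le_iff, SimpleGraph.edge_le_iff]
        simp only [SimpleGraph.fromEdgeSet_adj]
        exact ⟨Or.inr ⟨⟨f, hf⟩, hyz⟩, Or.inr ⟨⟨g, hg⟩, hzx⟩⟩)
      (SimpleGraph.isAcyclic_two_edges hxy hzx)
    obtain ⟨T, hT, himage⟩ := exists_isMaximalTree_of_isTree hF hle
    have hFyz : F.Adj y z := hF1 (Or.inl (by simp [SimpleGraph.edge_adj, hyz]))
    have hFzx : F.Adj z x := hF1 (Or.inr (by simp [SimpleGraph.edge_adj, hzx]))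
    obtain ⟨f', hf', hfe⟩ : s(y, z) ∈ ends '' T := himage ▸ hFyz
    obtain ⟨g', hg', hge⟩ : s(z, x) ∈ ends '' T := himage ▸ hFzx
    refine ⟨insert e T, T, e, hT, fun h => ?_, rfl,
      Or.inr ⟨x, y, z, hxy, hyz, hzx, he, f', hf', g', hg', hfe, hge⟩⟩
    exact hT.2.2.isAcyclic.not_triangle (hT.adj h he) (hT.adj hf' hfe) (hT.adj hg' hge)

end Multigraph

/-! ### Connectedness of the graph of cusps and edges -/

theorem OrientedFacePairing.connected_fromEdgeSet_ends {N : ℕ} (T : OrientedFacePairing N)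
    (h : T.IsConnected) : (SimpleGraph.fromEdgeSet (Set.range T.ends)).Connected := by
  have same : ∀ t u v,
      (SimpleGraph.fromEdgeSet (Set.range T.ends)).Reachable (T.cusp t u) (T.cusp t v) := by
    intro t u v
    by_cases hc : T.cusp t u = T.cusp t v
    · rw [hc]
    · have huv : u ≠ v := fun e => hc (e ▸ rfl)
      exact SimpleGraph.Adj.reachable
        ((SimpleGraph.fromEdgeSet_adj _).2 ⟨⟨T.edge t ⟨s(u, v), huv⟩, rfl⟩, hc⟩)
  have key : ∀ t t' u v,
      (SimpleGraph.fromEdgeSet (Set.range T.ends)).Reachable (T.cusp t u) (T.cusp t' v) := by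
    intro t t' u v
    induction h.2 t t' generalizing v with
    | refl => exact same t u v
    | tail _ hstep ih =>
      obtain ⟨f, rfl⟩ := hstep
      obtain ⟨w, hw⟩ := exists_ne f
      refine (ih w).trans ?_
      rw [← T.cusp_perm _ hw.symm]
      exact same _ _ _
  have : Nonempty T.Cusp := ⟨T.cusp ⟨0, h.1⟩ 0⟩
  refine ⟨?_⟩
  rintro ⟨t, u⟩ ⟨t', v⟩
  exact key t t' u v

namespace IdealTriangulation

variable {N : ℕ} (T : IdealTriangulation N)

/-! ### Relations between the edge equations -/

/-- The value of a function on the edges at the edge of tetrahedron `t` from `u` to `w`, with the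
value `0` for `u = w`. -/
def edgeValue (k : T.Edge → ℤ) (t : Fin N) (u w : Fin 4) : ℤ :=
  if h : u ≠ w then k (T.edge t ⟨s(u, w), h⟩) else 0

theorem edgeValue_comm (k : T.Edge → ℤ) (t : Fin N) (u w : Fin 4) :
    T.edgeValue k t u w = T.edgeValue k t w u := by
  by_cases h : u = w
  · rw [h]
  · rw [edgeValue, edgeValue, dif_pos h, dif_pos (Ne.symm h)]
    exact congrArg (fun p => k (T.edge t p)) (Subtype.ext Sym2.eq_swap)

theorem edgeValue_perm (k : T.Edge → ℤ) (t : Fin N) {f u w : Fin 4} (hu : f ≠ u) (hw : f ≠ w) :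
    T.edgeValue k (T.adj t f) (T.perm t f u) (T.perm t f w) = T.edgeValue k t u w := by
  by_cases h : u = w
  · simp [edgeValue, h]
  · have h' : T.perm t f u ≠ T.perm t f w := fun e => h ((T.perm t f).injective e)
    rw [edgeValue, edgeValue, dif_pos h, dif_pos h']
    exact congrArg k (Quot.sound ⟨f, by simp [hu, hw], rfl, rfl⟩).symm

/-- The sum over the edges that face a quad type. -/
def quadSum (k : T.Edge → ℤ) (t : Fin N) (q : Fin 3) : ℤ :=
  ∑ p ∈ facingEdges q, k (T.edge t p)

theorem quadSum_zero (k : T.Edge → ℤ) (t : Fin N) :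
    T.quadSum k t 0 = T.edgeValue k t 0 1 + T.edgeValue k t 2 3 :=
  Finset.sum_pair (by decide)

theorem quadSum_one (k : T.Edge → ℤ) (t : Fin N) :
    T.quadSum k t 1 = T.edgeValue k t 0 2 + T.edgeValue k t 1 3 :=
  Finset.sum_pair (by decide)

theorem quadSum_two (k : T.Edge → ℤ) (t : Fin N) :
    T.quadSum k t 2 = T.edgeValue k t 0 3 + T.edgeValue k t 1 2 :=
  Finset.sum_pair (by decide)

theorem sum_mul_angleCoeff [Fintype T.Edge] (k : T.Edge → ℤ) (t : Fin N) (q : Fin 3) :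
    ∑ e, k e * T.angleCoeff e t q = T.quadSum k t q := by
  classical
  simp only [angleCoeff, quadSum, Finset.card_filter, Nat.cast_sum, Finset.mul_sum]
  rw [Finset.sum_comm]
  simp

theorem sum_smul_edgeEquation_eq_zero_iff [Fintype T.Edge] (Q : Fin N → Fin 3)
    (k : T.Edge → ℤ) : ∑ e, k e • T.edgeEquation Q e = 0 ↔
      ∀ t q, T.quadSum k t q = T.quadSum k t 0 := by
  have hl : ∀ j, (∑ e, k e • T.edgeEquation Q e) (Sum.inl j) =
      T.quadSum k j (Q j - 1) - T.quadSum k j (Q j) := fun j => by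
    simp [edgeEquation, mul_sub, sum_mul_angleCoeff]
  have hr : ∀ j, (∑ e, k e • T.edgeEquation Q e) (Sum.inr j) =
      T.quadSum k j (Q j + 1) - T.quadSum k j (Q j) := fun j => by
    simp [edgeEquation, mul_sub, sum_mul_angleCoeff]
  constructor
  · intro h t q
    have h1 := hl t
    have h2 := hr t
    rw [h, Pi.zero_apply, eq_comm, sub_eq_zero] at h1 h2
    have hq : ∀ q : Fin 3, T.quadSum k t q = T.quadSum k t (Q t) := by
      intro q
      have : q = Q t - 1 ∨ q = Q t ∨ q = Q t + 1 := by
        generalize Q t = m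
        revert q m
        decide
      rcases this with rfl | rfl | rfl
      · exact h1
      · rfl
      · exact h2
    rw [hq q, hq 0]
  · intro h
    funext j
    rcases j with j | j
    · rw [hl, h, h j (Q j), sub_self, Pi.zero_apply]
    · rw [hr, h, h j (Q j), sub_self, Pi.zero_apply]

/-- The weight of a vertex of a tetrahedron. If the three sums over opposite edges agree, then the
value at each edge is half the sum of the weights of its ends. -/
def vertexWeight (k : T.Edge → ℤ) (t : Fin N) (v : Fin 4) : ℤ :=
  ∑ w, T.edgeValue k t v w - T.quadSum k t 0

/-- The weight of a vertex can be read off from any face that contains it. -/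
theorem vertexWeight_eq {k : T.Edge → ℤ} {t : Fin N}
    (hk : ∀ q, T.quadSum k t q = T.quadSum k t 0) {v u w : Fin 4} (hvu : v ≠ u) (hvw : v ≠ w)
    (huw : u ≠ w) : T.vertexWeight k t v =
      T.edgeValue k t v u + T.edgeValue k t v w - T.edgeValue k t u w := by
  have h1 := hk 1
  have h2 := hk 2
  rw [quadSum_zero, quadSum_one] at h1
  rw [quadSum_zero, quadSum_two] at h2
  have hd : ∀ v, T.edgeValue k t v v = 0 := fun v => by simp [edgeValue]
  have c01 := T.edgeValue_comm k t 1 0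
  have c02 := T.edgeValue_comm k t 2 0
  have c03 := T.edgeValue_comm k t 3 0
  have c12 := T.edgeValue_comm k t 2 1
  have c13 := T.edgeValue_comm k t 3 1
  have c23 := T.edgeValue_comm k t 3 2
  rw [vertexWeight, quadSum_zero, Fin.sum_univ_four]
  fin_cases v <;> fin_cases u <;> first | exact absurd rfl hvu | skip
  all_goals fin_cases w <;> first | exact absurd rfl hvw | exact absurd rfl huw | skip
  all_goals
    simp only [Fin.zero_eta, Fin.mk_one, Fin.reduceFinMk, hd]
    omega

/-- The weights of the vertices agree at the glued faces, and so they define a function on the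
cusps. -/
theorem exists_endSum_eq_two_mul {k : T.Edge → ℤ}
    (hk : ∀ t q, T.quadSum k t q = T.quadSum k t 0) :
    ∃ b : T.Cusp → ℤ, ∀ e, Sym2.endSum b (T.ends e) = 2 * k e := by
  have hglue : ∀ x y, T.VertexGlued x y →
      T.vertexWeight k x.1 x.2 = T.vertexWeight k y.1 y.2 := by
    rintro ⟨t, v⟩ _ ⟨f, hf, rfl⟩
    obtain ⟨u, w, hvu, hvw, huw, hfu, hfw⟩ :
        ∃ u w : Fin 4, v ≠ u ∧ v ≠ w ∧ u ≠ w ∧ f ≠ u ∧ f ≠ w := by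
      have aux : ∀ v f : Fin 4, f ≠ v →
          ∃ u w : Fin 4, v ≠ u ∧ v ≠ w ∧ u ≠ w ∧ f ≠ u ∧ f ≠ w := by decide
      exact aux v f hf
    have hσ := (T.perm t f).injective
    simp only
    rw [T.vertexWeight_eq (hk _) hvu hvw huw,
      T.vertexWeight_eq (hk _) (hσ.ne hvu) (hσ.ne hvw) (hσ.ne huw),
      T.edgeValue_perm k t hf hfu, T.edgeValue_perm k t hf hfw, T.edgeValue_perm k t hfu hfw]
  refine ⟨Quot.lift (fun x => T.vertexWeight k x.1 x.2) hglue, ?_⟩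
  rintro ⟨t, p, hp⟩
  induction p with | h u v =>
  have huv : u ≠ v := hp
  obtain ⟨w, huw, hvw⟩ : ∃ w : Fin 4, u ≠ w ∧ v ≠ w := by
    clear hp huv
    revert u v
    decide
  change T.vertexWeight k t u + T.vertexWeight k t v = 2 * k (T.edge t ⟨s(u, v), huv⟩)
  have he : T.edgeValue k t u v = k (T.edge t ⟨s(u, v), huv⟩) := dif_pos huv
  rw [T.vertexWeight_eq (hk _) huv huw hvw, T.vertexWeight_eq (hk _) huv.symm hvw huw,
    T.edgeValue_comm k t v u, he]
  ring

/-- The relations between the edge equations are the halves of the integral functions of end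
sums. -/
theorem sum_smul_edgeEquation_eq_zero_iff_exists [Fintype T.Edge] (Q : Fin N → Fin 3)
    (k : T.Edge → ℤ) : ∑ e, k e • T.edgeEquation Q e = 0 ↔
      ∃ b : T.Cusp → ℤ, ∀ e, Sym2.endSum b (T.ends e) = 2 * k e := by
  rw [sum_smul_edgeEquation_eq_zero_iff]
  refine ⟨T.exists_endSum_eq_two_mul, ?_⟩
  rintro ⟨b, hb⟩
  have hv : ∀ t u v, u ≠ v →
      2 * T.edgeValue k t u v = b (T.cusp t u) + b (T.cusp t v) := by
    intro t u v h
    rw [edgeValue, dif_pos h, ← hb]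
    rfl
  have key : ∀ t q, 2 * T.quadSum k t q = ∑ v, b (T.cusp t v) := by
    intro t q
    rw [Fin.sum_univ_four]
    fin_cases q
    · change 2 * T.quadSum k t 0 = _
      rw [quadSum_zero, mul_add, hv _ _ _ (by decide), hv _ _ _ (by decide)]
      ring
    · change 2 * T.quadSum k t 1 = _
      rw [quadSum_one, mul_add, hv _ _ _ (by decide), hv _ _ _ (by decide)]
      ring
    · change 2 * T.quadSum k t 2 = _
      rw [quadSum_two, mul_add, hv _ _ _ (by decide), hv _ _ _ (by decide)]
      ring
  intro t q
  have h1 := key t q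
  have h2 := key t 0
  omega

/-- Restriction to `S` maps the relations bijectively to the integer functions on `S`: injectivity
is linear independence of the remaining edge equations, and surjectivity says that they generate. -/
theorem isIntegerBasis_compl (Q : Fin N → Fin 3) {S : Set T.Edge}
    (hS : IsMaximalTreeWithCycle T.ends S) : T.IsIntegerBasis Q Sᶜ := by
  have := Fintype.ofFinite T.Edge
  constructor
  · change LinearIndepOn ℤ (T.edgeEquation Q) Sᶜ
    rw [linearIndepOn_iff]
    intro l hl h0
    rw [Finsupp.linearCombination_apply, Finsupp.sum_fintype _ _ (by simp),
      sum_smul_edgeEquation_eq_zero_iff_exists] at h0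
    obtain ⟨b, hb⟩ := h0
    rw [Finsupp.mem_supported'] at hl
    have hb0 : b = 0 := hS.eq_zero_of_endSum fun e he => by
      rw [hb, hl e (by simpa using he), mul_zero]
    ext e
    have h := hb e
    rw [hb0] at h
    have h0 : Sym2.endSum (0 : T.Cusp → ℤ) (T.ends e) = 0 := by
      induction T.ends e with | h u v => rfl
    rw [h0] at h
    simp only [Finsupp.coe_zero, Pi.zero_apply]
    omega
  · apply le_antisymm
    · exact Submodule.span_mono (Set.image_subset_range _ _)
    · rw [edgeLattice, Submodule.span_le]
      rintro _ ⟨s, rfl⟩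
      by_cases hs : s ∈ S
      · -- A relation in which the coefficients of the edges in `S` are `1` at `s` and `0` elsewhere
        -- expresses the equation of `s` by those of the edges outside `S`.
        classical
        obtain ⟨b, ⟨m, hm⟩, hb⟩ := hS.exists_endSum (Pi.single s 1)
        choose k hk using fun e => (Sym2.even_endSum hm (T.ends e)).exists_two_nsmul
        have hrel := (T.sum_smul_edgeEquation_eq_zero_iff_exists Q k).2
          ⟨b, fun e => by rw [hk e]; simp⟩
        have hkS : ∀ e ∈ S, k e = (Pi.single s 1 : T.Edge → ℤ) e := by
          intro e he
          have h1 := hb e he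
          rw [hk e, nsmul_eq_mul] at h1
          push_cast at h1
          omega
        rw [← Finset.add_sum_erase _ _ (Finset.mem_univ s), hkS s hs, Pi.single_eq_same, one_smul,
          add_eq_zero_iff_eq_neg] at hrel
        rw [SetLike.mem_coe, hrel]
        refine Submodule.neg_mem _ (Submodule.sum_mem _ fun e he => ?_)
        by_cases heS : e ∈ S
        · rw [hkS e heS, Pi.single_eq_of_ne (Finset.ne_of_mem_erase he), zero_smul]
          exact Submodule.zero_mem _
        · exact Submodule.smul_mem _ _ (Submodule.subset_span ⟨e, heS, rfl⟩)
      · exact Submodule.subset_span ⟨s, hs, rfl⟩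

end IdealTriangulation

theorem mainTheorem6 {N : ℕ} (T : IdealTriangulation N) (Q : Fin N → Fin 3) :
    (∃ B : Set T.Edge, B.ncard + T.numCusps = N ∧ T.IsIntegerBasis Q B) ∧
    (∃ S : Set T.Edge, IsMaximalTreeWithCycle T.ends S) ∧
    (∀ S : Set T.Edge, IsMaximalTreeWithCycle T.ends S →
      S.ncard = T.numCusps ∧ Sᶜ.ncard + T.numCusps = N ∧ T.IsIntegerBasis Q Sᶜ) := by
  have hS : ∀ S : Set T.Edge, IsMaximalTreeWithCycle T.ends S →
      S.ncard = T.numCusps ∧ Sᶜ.ncard + T.numCusps = N ∧ T.IsIntegerBasis Q Sᶜ := by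
    intro S h
    have hc : S.ncard = T.numCusps := h.ncard
    refine ⟨hc, ?_, T.isIntegerBasis_compl Q h⟩
    rw [← hc, add_comm, Set.ncard_add_ncard_compl, T.card_edge T.torus_cusps]
  -- The edges of a face of a tetrahedron form a closed path of length three.
  have hex : ∃ S : Set T.Edge, IsMaximalTreeWithCycle T.ends S := by
    let t : Fin N := ⟨0, T.connected.1⟩
    exact exists_isMaximalTreeWithCycle (T.connected_fromEdgeSet_ends T.connected)
      (e := T.edge t ⟨s(0, 1), by decide⟩) (f := T.edge t ⟨s(1, 2), by decide⟩)
      (g := T.edge t ⟨s(2, 0), by decide⟩) rfl rfl rfl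
  obtain ⟨S, h⟩ := hex
  exact ⟨⟨Sᶜ, (hS S h).2⟩, ⟨S, h⟩, hS⟩
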